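/- A pseudo MV-algebra is an algebra $(M;\oplus,{}^-,{}^\sim,0,1)$ of type $(2,1,1,0,0)$ such that, with $x\odot y:=(y^-\oplus x^-)^\sim$, for all $x,y,z\in M$: $\oplus$ is associative; $x\oplus 0=0\oplus x=x$; $x\oplus 1=1\oplus x=1$; $1^-=1^\sim=0$; $(x^-\oplus y^-)^\sim=(x^\sim\oplus y^\sim)^-$; $x\oplus(x^\sim\odot y)=y\oplus(y^\sim\odot x)=(x\odot y^-)\oplus y=(y\odot x^-)\oplus x$; $x\odot(x^-\oplus y)=(x\oplus y^\sim)\odot y$; $(x^-)^\sim=x$. It is ordered by its lattice order, with meet $x\wedge y=x\odot(x^-\oplus y)$; it is an MV-algebra if $\oplus$ is commutative, and it is representable if it is a subdirect product of linearly ordered pseudo MV-algebras. A weak square root on $M$ is a map $r:M\to M$ such that $r(x)\odot r(x)=x$ for all $x$, and $y\odot y\le x$ implies $y\le r(x)$ for all $x,y$. A square root is a weak square root that also satisfies $r(x^-)=r(x)^-\oplus r(0)$ and $r(x^\sim)=r(0)\oplus r(x)^\sim$ for all $x$ (for MV-algebras the two notions coincide). $M$ is strict if it has a square root or a weak square root $r$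 with $r(0)=r(0)^-$. An ideal is a nonempty down-set $I\subseteq M$ closed under $\oplus$; it is normal if $x\oplus I=I\oplus x$ for all $x\in M$, and prime if $x\wedge y\in I$ implies $x\in I$ or $y\in I$. For a normal ideal $P$, $M/P$ is the quotient of $M$ by the congruence under which $x$ and $y$ are equivalent iff $x\odot y^-\in P$ and $y\odot x^-\in P$, and $x/P$ denotes the class of $x$. $M$ is strongly atomless if for each $x\in M\setminus\{0\}$ there is a normal prime ideal $P$ of $M$ such that $x\notin P$ and $x/P$ is not an atom of $M/P$. Theorem. Let $M$ be a representable pseudo MV-algebra. If $M$ is strict (in particular, if $M$ has a strict square root), then $M$ is strongly atomless. In particular, every strict MV-algebra is strongly atomless. -/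

import Mathlib

universe u v

/-- A pseudo MV-algebra: an algebra of type (2,1,1,0,0), not necessarily commutative. Here `lneg x`
is `x⁻` and `rneg x` is `x^∼`. In the axioms, the derived operation
`x ⊙ y = (y⁻ ⊕ x⁻)^∼` is written out. -/
class PseudoMVAlgebra (M : Type u) extends Zero M, One M where
  oplus : M → M → M
  lneg : M → M
  rneg : M → M
  oplus_assoc : ∀ x y z : M, oplus x (oplus y z) = oplus (oplus x y) z
  oplus_zero : ∀ x : M, oplus x 0 = x
  zero_oplus : ∀ x : M, oplus 0 x = x
  oplus_one : ∀ x : M, oplus x 1 = 1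
  one_oplus : ∀ x : M, oplus 1 x = 1
  lneg_one : lneg 1 = 0
  rneg_one : rneg 1 = 0
  rneg_oplus_lneg : ∀ x y : M, rneg (oplus (lneg x) (lneg y)) = lneg (oplus (rneg x) (rneg y))
  /-- `x ⊕ (x^∼ ⊙ y) = y ⊕ (y^∼ ⊙ x)` -/
  sup_eq₁ : ∀ x y : M, oplus x (rneg (oplus (lneg y) (lneg (rneg x)))) =
    oplus y (rneg (oplus (lneg x) (lneg (rneg y))))
  /-- `y ⊕ (y^∼ ⊙ x) = (x ⊙ y⁻) ⊕ y` -/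
  sup_eq₂ : ∀ x y : M, oplus y (rneg (oplus (lneg x) (lneg (rneg y)))) =
    oplus (rneg (oplus (lneg (lneg y)) (lneg x))) y
  /-- `(x ⊙ y⁻) ⊕ y = (y ⊙ x⁻) ⊕ x` -/
  sup_eq₃ : ∀ x y : M, oplus (rneg (oplus (lneg (lneg y)) (lneg x))) y =
    oplus (rneg (oplus (lneg (lneg x)) (lneg y))) x
  /-- `x ⊙ (x⁻ ⊕ y) = (x ⊕ y^∼) ⊙ y` -/
  inf_eq : ∀ x y : M, rneg (oplus (lneg (oplus (lneg x) y)) (lneg x)) =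
    rneg (oplus (lneg y) (lneg (oplus x (rneg y))))
  rneg_lneg : ∀ x : M, rneg (lneg x) = x

namespace PseudoMVAlgebra

infixl:65 " ⊕ₘ " => PseudoMVAlgebra.oplus

/-- `x ⊙ y = (y⁻ ⊕ x⁻)^∼`. -/
def odot {M : Type u} [PseudoMVAlgebra M] (x y : M) : M := rneg (lneg y ⊕ₘ lneg x)

infixl:70 " ⊙ₘ " => PseudoMVAlgebra.odot

/-- The lattice meet `x ∧ y = x ⊙ (x⁻ ⊕ y)`. -/
def inf {M : Type u} [PseudoMVAlgebra M] (x y : M) : M := x ⊙ₘ (lneg x ⊕ₘ y)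

section Basic

variable {M : Type u} [PseudoMVAlgebra M]

theorem rneg_zero : rneg (0 : M) = 1 := by
  rw [← lneg_one (M := M), rneg_lneg]

theorem lneg_zero : lneg (0 : M) = 1 := by
  have h := rneg_oplus_lneg (1 : M) 1
  rw [lneg_one, rneg_one, oplus_zero, rneg_zero] at h
  exact h.symm

theorem lneg_rneg (x : M) : lneg (rneg x) = x := by
  have h := rneg_oplus_lneg x 1
  rw [lneg_one, rneg_one, oplus_zero, oplus_zero, rneg_lneg] at h
  exact h.symm

theorem odot_one (x : M) : x ⊙ₘ 1 = x := by
  rw [odot, lneg_one, zero_oplus, rneg_lneg]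

theorem one_odot (x : M) : 1 ⊙ₘ x = x := by
  rw [odot, lneg_one, oplus_zero, rneg_lneg]

theorem oplus_rneg_self (x : M) : x ⊕ₘ rneg x = 1 := by
  have h := sup_eq₁ x 1
  rwa [lneg_one, zero_oplus, rneg_lneg, one_oplus] at h

theorem lneg_oplus_self (x : M) : lneg x ⊕ₘ x = 1 := by
  have h := oplus_rneg_self (lneg x)
  rwa [rneg_lneg] at h

theorem odot_lneg (x y : M) : x ⊙ₘ lneg y = lneg (y ⊕ₘ rneg x) := by
  rw [odot, rneg_oplus_lneg, rneg_lneg]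

theorem rneg_odot (x y : M) : rneg x ⊙ₘ y = rneg (lneg y ⊕ₘ x) := by
  rw [odot, lneg_rneg]

theorem join₁ (x y : M) : x ⊕ₘ (rneg x ⊙ₘ y) = y ⊕ₘ (rneg y ⊙ₘ x) := sup_eq₁ x y

theorem join₂ (x y : M) : y ⊕ₘ (rneg y ⊙ₘ x) = (x ⊙ₘ lneg y) ⊕ₘ y := sup_eq₂ x y

theorem inf_eq_self_iff (x y : M) : inf x y = x ↔ lneg x ⊕ₘ y = 1 := by
  constructor
  · intro h
    have key : lneg x ⊕ₘ (x ⊙ₘ (lneg x ⊕ₘ y)) = lneg x ⊕ₘ y := by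
      have h1 := join₁ (lneg x) (lneg x ⊕ₘ y)
      rw [rneg_lneg, rneg_odot, oplus_assoc, lneg_oplus_self, one_oplus, rneg_one,
        oplus_zero] at h1
      exact h1
    rw [inf] at h
    rw [h, lneg_oplus_self] at key
    exact key.symm
  · intro h
    rw [inf, h, odot_one]

theorem exists_oplus_of (x y : M) (h : y ⊕ₘ rneg x = 1) : ∃ c, y = x ⊕ₘ c := by
  refine ⟨rneg x ⊙ₘ y, ?_⟩
  rw [join₁, join₂, odot_lneg, h, lneg_one, zero_oplus]

theorem exists_oplus_of' (x y : M) (h : lneg x ⊕ₘ y = 1) : ∃ c, y = c ⊕ₘ x := by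
  refine ⟨y ⊙ₘ lneg x, ?_⟩
  rw [← join₂, join₁, rneg_odot, h, rneg_one, oplus_zero]

theorem one_iff (x y : M) : lneg x ⊕ₘ y = 1 ↔ y ⊕ₘ rneg x = 1 := by
  constructor
  · intro h
    obtain ⟨c, rfl⟩ := exists_oplus_of' x y h
    rw [← oplus_assoc, oplus_rneg_self, oplus_one]
  · intro h
    obtain ⟨c, rfl⟩ := exists_oplus_of x y h
    rw [oplus_assoc, lneg_oplus_self, one_oplus]

end Basic

/-- The lattice order: `x ≤ y` means `x ∧ y = x`. -/
instance instPartialOrder (M : Type u) [PseudoMVAlgebra M] : PartialOrder M where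
  le x y := inf x y = x
  le_refl x := (inf_eq_self_iff x x).2 (lneg_oplus_self x)
  le_trans x y z hxy hyz := by
    rw [inf_eq_self_iff] at *
    obtain ⟨c, rfl⟩ := exists_oplus_of y z ((one_iff y z).1 hyz)
    rw [oplus_assoc, hxy, one_oplus]
  le_antisymm x y hxy hyx := by
    have h1 : inf x y = (x ⊕ₘ rneg y) ⊙ₘ y := inf_eq x y
    rw [inf_eq_self_iff, one_iff] at hyx
    rw [hxy, hyx, one_odot] at h1
    exact h1

section Order

variable {M : Type u} [PseudoMVAlgebra M]

theorem le_iff_inf (x y : M) : x ≤ y ↔ inf x y = x := Iff.rfl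

theorem le_iff (x y : M) : x ≤ y ↔ lneg x ⊕ₘ y = 1 := inf_eq_self_iff x y

theorem le_iff' (x y : M) : x ≤ y ↔ y ⊕ₘ rneg x = 1 := (le_iff x y).trans (one_iff x y)

end Order

instance instOrderBot (M : Type u) [PseudoMVAlgebra M] : OrderBot M where
  bot := 0
  bot_le x := by
    show (0 : M) ≤ x
    rw [le_iff, lneg_zero, one_oplus]

section Order

variable {M : Type u} [PseudoMVAlgebra M]

theorem bot_eq_zero : (⊥ : M) = 0 := rfl

theorem odot_lneg_le_iff (x y z : M) : x ⊙ₘ lneg y ≤ z ↔ x ≤ z ⊕ₘ y := by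
  rw [le_iff', odot_lneg, rneg_lneg, oplus_assoc, ← le_iff']

theorem oplus_le_oplus {a b c d : M} (h : a ≤ b) (h' : c ≤ d) : a ⊕ₘ c ≤ b ⊕ₘ d := by
  have h1 : a ⊕ₘ c ≤ a ⊕ₘ d := by
    obtain ⟨e, rfl⟩ := exists_oplus_of c d ((le_iff' c d).1 h')
    rw [le_iff, oplus_assoc a, oplus_assoc (lneg (a ⊕ₘ c)), lneg_oplus_self, one_oplus]
  have h2 : a ⊕ₘ d ≤ b ⊕ₘ d := by
    obtain ⟨e, rfl⟩ := exists_oplus_of' a b ((le_iff a b).1 h)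
    rw [le_iff', ← oplus_assoc e, ← oplus_assoc e, oplus_rneg_self, oplus_one]
  exact h1.trans h2

end Order

/-- A normal ideal of a pseudo MV-algebra: a nonempty down-set, closed under `⊕`, with
`x ⊕ I = I ⊕ x` for every `x`. -/
structure NormalIdeal (M : Type u) [PseudoMVAlgebra M] where
  carrier : Set M
  nonempty : carrier.Nonempty
  mem_of_le : ∀ x y : M, y ≤ x → x ∈ carrier → y ∈ carrier
  oplus_mem : ∀ x y : M, x ∈ carrier → y ∈ carrier → x ⊕ₘ y ∈ carrier
  normal : ∀ x : M, (fun i => x ⊕ₘ i) '' carrier = (fun i => i ⊕ₘ x) '' carrier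

namespace NormalIdeal

variable {M : Type u} [PseudoMVAlgebra M] (I : NormalIdeal M)

/-- `I` is prime: `x ∧ y ∈ I` implies `x ∈ I` or `y ∈ I`. -/
def IsPrime : Prop := ∀ x y : M, inf x y ∈ I.carrier → x ∈ I.carrier ∨ y ∈ I.carrier

/-- The relation `x ∼_I y`: both `x ⊙ y⁻` and `y ⊙ x⁻` lie in `I`. -/
def Rel (x y : M) : Prop := x ⊙ₘ lneg y ∈ I.carrier ∧ y ⊙ₘ lneg x ∈ I.carrier

theorem odot_mem_iff (x y : M) : x ⊙ₘ lneg y ∈ I.carrier ↔ ∃ i ∈ I.carrier, x ≤ i ⊕ₘ y := by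
  constructor
  · intro h
    exact ⟨_, h, (odot_lneg_le_iff x y _).1 le_rfl⟩
  · rintro ⟨i, hi, h⟩
    exact I.mem_of_le i _ ((odot_lneg_le_iff x y i).2 h) hi

theorem exists_right (x i : M) (hi : i ∈ I.carrier) : ∃ j ∈ I.carrier, x ⊕ₘ j = i ⊕ₘ x := by
  have h : i ⊕ₘ x ∈ (fun i => i ⊕ₘ x) '' I.carrier := ⟨i, hi, rfl⟩
  rw [← I.normal x] at h
  exact h

theorem exists_left (x i : M) (hi : i ∈ I.carrier) : ∃ j ∈ I.carrier, j ⊕ₘ x = x ⊕ₘ i := by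
  have h : x ⊕ₘ i ∈ (fun i => x ⊕ₘ i) '' I.carrier := ⟨i, hi, rfl⟩
  rw [I.normal x] at h
  exact h

theorem mem_trans {x y z : M} (h : x ⊙ₘ lneg y ∈ I.carrier) (h' : y ⊙ₘ lneg z ∈ I.carrier) :
    x ⊙ₘ lneg z ∈ I.carrier := by
  rw [odot_mem_iff] at *
  obtain ⟨i, hi, h⟩ := h
  obtain ⟨j, hj, h'⟩ := h'
  refine ⟨i ⊕ₘ j, I.oplus_mem i j hi hj, h.trans ?_⟩
  rw [← oplus_assoc]
  exact oplus_le_oplus le_rfl h'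

theorem mem_oplus {x y a b : M} (h : x ⊙ₘ lneg y ∈ I.carrier) (h' : a ⊙ₘ lneg b ∈ I.carrier) :
    (x ⊕ₘ a) ⊙ₘ lneg (y ⊕ₘ b) ∈ I.carrier := by
  rw [odot_mem_iff] at *
  obtain ⟨i, hi, h⟩ := h
  obtain ⟨j, hj, h'⟩ := h'
  obtain ⟨k, hk, e⟩ := I.exists_left y j hj
  refine ⟨i ⊕ₘ k, I.oplus_mem i k hi hk, (oplus_le_oplus h h').trans (le_of_eq ?_)⟩
  rw [oplus_assoc (i ⊕ₘ y), ← oplus_assoc i y, ← e, oplus_assoc i k, oplus_assoc]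

theorem mem_lneg {x y : M} (h : x ⊙ₘ lneg y ∈ I.carrier) :
    lneg y ⊙ₘ lneg (lneg x) ∈ I.carrier := by
  rw [odot_mem_iff] at *
  obtain ⟨i, hi, h⟩ := h
  obtain ⟨k, hk, e⟩ := I.exists_left (lneg x) i hi
  refine ⟨k, hk, ?_⟩
  rw [e, le_iff', rneg_lneg, ← oplus_assoc, ← le_iff]
  exact h

theorem mem_rneg {x y : M} (h : x ⊙ₘ lneg y ∈ I.carrier) :
    rneg y ⊙ₘ lneg (rneg x) ∈ I.carrier := by
  rw [odot_mem_iff] at *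
  obtain ⟨i, hi, h⟩ := h
  obtain ⟨k, hk, e⟩ := I.exists_right y i hi
  refine ⟨k, hk, ?_⟩
  rw [le_iff, lneg_rneg, oplus_assoc, e, ← le_iff']
  exact h

/-- `∼_I` as an equivalence relation. -/
def setoid : Setoid M where
  r := I.Rel
  iseqv :=
    { refl := fun x => by
        obtain ⟨i, hi⟩ := I.nonempty
        have h : x ⊙ₘ lneg x ∈ I.carrier := by
          refine I.mem_of_le i _ ?_ hi
          rw [odot_lneg, oplus_rneg_self, lneg_one]
          exact bot_le
        exact ⟨h, h⟩
      symm := fun h => ⟨h.2, h.1⟩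
      trans := fun h h' => ⟨I.mem_trans h.1 h'.1, I.mem_trans h'.2 h.2⟩ }

/-- The quotient `M / I`. -/
def Quot : Type u := Quotient I.setoid

/-- The class `x / I`. -/
def toQuot (x : M) : I.Quot := Quotient.mk I.setoid x

/-- The pseudo MV-algebra structure of `M / I`, with all operations computed on
representatives. -/
instance instPseudoMVAlgebraQuot : PseudoMVAlgebra I.Quot where
  zero := I.toQuot 0
  one := I.toQuot 1
  oplus := Quotient.map₂ (fun x y : M => x ⊕ₘ y)
    fun _ _ h _ _ h' => ⟨I.mem_oplus h.1 h'.1, I.mem_oplus h.2 h'.2⟩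
  lneg := Quotient.map (fun x : M => lneg x) fun _ _ h => ⟨I.mem_lneg h.2, I.mem_lneg h.1⟩
  rneg := Quotient.map (fun x : M => rneg x) fun _ _ h => ⟨I.mem_rneg h.2, I.mem_rneg h.1⟩
  oplus_assoc := by
    rintro ⟨x⟩ ⟨y⟩ ⟨z⟩
    exact congrArg I.toQuot (oplus_assoc x y z)
  oplus_zero := by
    rintro ⟨x⟩
    exact congrArg I.toQuot (oplus_zero x)
  zero_oplus := by
    rintro ⟨x⟩
    exact congrArg I.toQuot (zero_oplus x)
  oplus_one := by
    rintro ⟨x⟩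
    exact congrArg I.toQuot (oplus_one x)
  one_oplus := by
    rintro ⟨x⟩
    exact congrArg I.toQuot (one_oplus x)
  lneg_one := congrArg I.toQuot lneg_one
  rneg_one := congrArg I.toQuot rneg_one
  rneg_oplus_lneg := by
    rintro ⟨x⟩ ⟨y⟩
    exact congrArg I.toQuot (rneg_oplus_lneg x y)
  sup_eq₁ := by
    rintro ⟨x⟩ ⟨y⟩
    exact congrArg I.toQuot (sup_eq₁ x y)
  sup_eq₂ := by
    rintro ⟨x⟩ ⟨y⟩
    exact congrArg I.toQuot (sup_eq₂ x y)
  sup_eq₃ := by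
    rintro ⟨x⟩ ⟨y⟩
    exact congrArg I.toQuot (sup_eq₃ x y)
  inf_eq := by
    rintro ⟨x⟩ ⟨y⟩
    exact congrArg I.toQuot (inf_eq x y)
  rneg_lneg := by
    rintro ⟨x⟩
    exact congrArg I.toQuot (rneg_lneg x)

end NormalIdeal

/-- Homomorphisms of pseudo MV-algebras. -/
structure IsHom {M : Type u} {N : Type v} [PseudoMVAlgebra M] [PseudoMVAlgebra N]
    (f : M → N) : Prop where
  map_zero : f 0 = 0
  map_one : f 1 = 1
  map_oplus : ∀ x y : M, f (x ⊕ₘ y) = f x ⊕ₘ f y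
  map_lneg : ∀ x : M, f (lneg x) = lneg (f x)
  map_rneg : ∀ x : M, f (rneg x) = rneg (f x)

/-- `M` is representable: a subdirect product of linearly ordered pseudo MV-algebras, that is,
it embeds into a product of chains so that every coordinate map is onto. -/
def IsRepresentable (M : Type u) [PseudoMVAlgebra M] : Prop :=
  ∃ (ι : Type u) (C : ι → Type u) (_ : ∀ i, PseudoMVAlgebra (C i)) (f : ∀ i, M → C i),
    (∀ i, ∀ a b : C i, a ≤ b ∨ b ≤ a) ∧
    (∀ i, IsHom (f i)) ∧
    (∀ i, Function.Surjective (f i)) ∧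
    Function.Injective (fun (x : M) (i : ι) => f i x)

/-- An MV-algebra is a pseudo MV-algebra whose operation `⊕` is commutative. -/
def IsMVAlgebra (M : Type u) [PseudoMVAlgebra M] : Prop :=
  ∀ x y : M, x ⊕ₘ y = y ⊕ₘ x

/-- A weak square root. On an MV-algebra this is what is called a square root. -/
structure IsWeakSquareRoot {M : Type u} [PseudoMVAlgebra M] (r : M → M) : Prop where
  odot_self : ∀ x : M, r x ⊙ₘ r x = x
  le_of_odot_self_le : ∀ x y : M, y ⊙ₘ y ≤ x → y ≤ r x

/-- A square root: a weak square root with `r(x⁻) = r(x) → r(0)` and `r(x^∼) = r(x) ⇝ r(0)`,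
where `x → y = x⁻ ⊕ y` and `x ⇝ y = y ⊕ x^∼`. -/
structure IsSquareRoot {M : Type u} [PseudoMVAlgebra M] (r : M → M) : Prop
    extends IsWeakSquareRoot r where
  map_lneg : ∀ x : M, r (lneg x) = lneg (r x) ⊕ₘ r 0
  map_rneg : ∀ x : M, r (rneg x) = r 0 ⊕ₘ rneg (r x)

/-- `M` is strict: it has a square root or a weak square root `r` with `r(0) = r(0)⁻`. -/
def IsStrict (M : Type u) [PseudoMVAlgebra M] : Prop :=
  ∃ r : M → M, (IsSquareRoot r ∨ IsWeakSquareRoot r) ∧ r 0 = lneg (r 0)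

/-- `M` is strongly atomless: for every `x ≠ 0` there is a normal prime ideal `P` with `x ∉ P`
such that `x / P` is not an atom of `M / P`. -/
def IsStronglyAtomless (M : Type u) [PseudoMVAlgebra M] : Prop :=
  ∀ x : M, x ≠ 0 → ∃ P : NormalIdeal M, P.IsPrime ∧ x ∉ P.carrier ∧ ¬ IsAtom (P.toQuot x)

end PseudoMVAlgebra

/-! Strictness yields two facts that survive in every quotient: each element is a square, and some
`a` equals `lneg a`. If `P` is prime, `0` is moreover meet-prime in `M / P`, and these three
properties exclude atoms (`not_isAtom_of_forall_exists_odot_self`). Indeed, a square root of `c⁻`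
for an atom `c` must be `c⁻` itself, so `c ⊕ c = c` and `c ∧ c⁻ = 0`. Primality forces `c = 1`, so
the quotient is `{0, 1}`, which has no self-negated element.

It remains to find a normal prime ideal missing a given `x ≠ 0`. In the representable case the
kernel of a coordinate map into a chain serves. In the commutative case every ideal is normal, and
an ideal maximal among those missing `x` is prime. -/

namespace PseudoMVAlgebra

/-! ### Order, residuation and distributivity; exclusion of atoms -/

section Lattice

variable {M : Type u} [PseudoMVAlgebra M]

theorem lneg_le_lneg {x y : M} (h : x ≤ y) : lneg y ≤ lneg x := by
  rwa [le_iff', rneg_lneg, ← le_iff]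

theorem rneg_le_rneg {x y : M} (h : x ≤ y) : rneg y ≤ rneg x := by
  rwa [le_iff, lneg_rneg, ← le_iff']

theorem odot_le_odot {a b c d : M} (h : a ≤ b) (h' : c ≤ d) : a ⊙ₘ c ≤ b ⊙ₘ d :=
  rneg_le_rneg (oplus_le_oplus (lneg_le_lneg h') (lneg_le_lneg h))

protected theorem zero_le (x : M) : (0 : M) ≤ x := bot_le (a := x)

protected theorem le_one (x : M) : x ≤ 1 := by
  rw [le_iff, oplus_one]

theorem odot_le_left (x y : M) : x ⊙ₘ y ≤ x := by
  simpa only [odot_one] using odot_le_odot (le_refl x) (PseudoMVAlgebra.le_one y)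

theorem odot_le_right (x y : M) : x ⊙ₘ y ≤ y := by
  simpa only [one_odot] using odot_le_odot (PseudoMVAlgebra.le_one x) (le_refl y)

theorem odot_lneg_self (x : M) : x ⊙ₘ lneg x = 0 := by
  rw [odot_lneg, oplus_rneg_self, lneg_one]

theorem inf_eq_odot (x y : M) : inf x y = (x ⊕ₘ rneg y) ⊙ₘ y := inf_eq x y

theorem inf_le_fst (x y : M) : inf x y ≤ x := odot_le_left _ _

theorem inf_le_snd (x y : M) : inf x y ≤ y := by
  rw [inf_eq_odot]
  exact odot_le_right _ _

/-- The second form `(x ⊕ y^∼) ⊙ y` of the meet is isotone in `x`, and `t = t ∧ y`. -/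
theorem le_inf_of_le {t x y : M} (hx : t ≤ x) (hy : t ≤ y) : t ≤ inf x y := by
  have h : inf t y = t := hy
  rw [inf_eq_odot] at h ⊢
  rw [← h]
  exact odot_le_odot (oplus_le_oplus hx le_rfl) le_rfl

theorem inf_comm' (x y : M) : inf x y = inf y x :=
  le_antisymm (le_inf_of_le (inf_le_snd x y) (inf_le_fst x y))
    (le_inf_of_le (inf_le_snd y x) (inf_le_fst y x))

theorem le_oplus_left (x y : M) : x ≤ x ⊕ₘ y := by
  simpa only [oplus_zero] using oplus_le_oplus (le_refl x) (PseudoMVAlgebra.zero_le y)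

theorem le_oplus_right (x y : M) : y ≤ x ⊕ₘ y := by
  simpa only [zero_oplus] using oplus_le_oplus (PseudoMVAlgebra.zero_le x) (le_refl y)

theorem le_inf_oplus {t p q z : M} (hp : t ≤ p ⊕ₘ z) (hq : t ≤ q ⊕ₘ z) :
    t ≤ inf p q ⊕ₘ z := by
  rw [← odot_lneg_le_iff] at *
  exact le_inf_of_le hp hq

theorem rneg_odot_le_iff (x y z : M) : rneg x ⊙ₘ y ≤ z ↔ y ≤ x ⊕ₘ z := by
  rw [le_iff, rneg_odot, lneg_rneg, ← oplus_assoc, ← le_iff]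

theorem le_oplus_inf {t p q z : M} (hp : t ≤ z ⊕ₘ p) (hq : t ≤ z ⊕ₘ q) :
    t ≤ z ⊕ₘ inf p q := by
  rw [← rneg_odot_le_iff] at *
  exact le_inf_of_le hp hq

/-- By residuation `⊕` distributes over meets on each side, so it suffices to compare with `u ⊕ (u ∧
w)`, `v ⊕ u` and `v ⊕ w`. This is what makes `{w | u ∧ w ∈ I}` closed under `⊕`. -/
theorem inf_oplus_le (u v w : M) : inf u (v ⊕ₘ w) ≤ inf u v ⊕ₘ inf u w := by
  have hu := inf_le_fst u (v ⊕ₘ w)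
  exact le_inf_oplus (hu.trans (le_oplus_left _ _))
    (le_oplus_inf (hu.trans (le_oplus_right _ _)) (inf_le_snd _ _))

theorem le_zero_iff' {x : M} : x ≤ 0 ↔ x = 0 := le_bot_iff (a := x)

/-- If `0` is meet-prime, every element is a square and some element is its own negation, then
there are no atoms. -/
theorem not_isAtom_of_forall_exists_odot_self
    (hprime : ∀ x y : M, inf x y = 0 → x = 0 ∨ y = 0)
    (hsq : ∀ x : M, ∃ y, y ⊙ₘ y = x) (hneg : ∃ a : M, a = lneg a) (c : M) :
    ¬ IsAtom c := by
  rintro ⟨hc0, hc⟩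
  replace hc0 : c ≠ 0 := hc0
  have dich : ∀ b : M, b ≤ c → b = 0 ∨ b = c := fun b hb =>
    (eq_or_lt_of_le hb).symm.imp (hc b) id
  have h01 : (0 : M) ≠ 1 := fun h =>
    hc0 (le_zero_iff'.1 ((PseudoMVAlgebra.le_one c).trans h.ge))
  obtain ⟨b, hb⟩ := hsq (lneg c)
  -- From `c⁻ = b ⊙ b ≤ b`, negation gives `b^∼ ≤ c`, and the atom leaves only `b^∼ = 0` or `b^∼ =
  -- c`.
  have hbc : rneg b ≤ c := by
    have h := rneg_le_rneg (odot_le_left b b)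
    rwa [hb, rneg_lneg] at h
  have hidem : c ⊕ₘ c = c := by
    rcases dich _ hbc with h | h
    · have hb1 : b = 1 := by rw [← lneg_rneg b, h, lneg_zero]
      rw [hb1, odot_one] at hb
      refine absurd ?_ hc0
      rw [← rneg_lneg c, ← hb, rneg_one]
    · have hb' : b = lneg c := by rw [← h, lneg_rneg]
      rw [hb', odot_lneg, rneg_lneg] at hb
      rw [← rneg_lneg (c ⊕ₘ c), hb, rneg_lneg]
  have hinf : inf c (lneg c) = 0 := by
    rw [inf_eq_odot, rneg_lneg, hidem, odot_lneg_self]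
  have hc1 : c = 1 := by
    rw [← rneg_lneg c, (hprime _ _ hinf).resolve_left hc0, rneg_zero]
  obtain ⟨a, ha⟩ := hneg
  rcases dich a (hc1 ▸ PseudoMVAlgebra.le_one a) with h | h
  · rw [h, lneg_zero] at ha
    exact h01 ha
  · rw [h, hc1, lneg_one] at ha
    exact h01 ha.symm

end Lattice

/-! ### Prime quotients of a strict algebra -/

namespace NormalIdeal

variable {M : Type u} [PseudoMVAlgebra M]

theorem zero_mem (I : NormalIdeal M) : (0 : M) ∈ I.carrier := by
  obtain ⟨i, hi⟩ := I.nonempty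
  exact I.mem_of_le i 0 (PseudoMVAlgebra.zero_le i) hi

theorem toQuot_eq_zero_iff (I : NormalIdeal M) (x : M) : I.toQuot x = 0 ↔ x ∈ I.carrier := by
  have h : I.toQuot x = I.toQuot 0 ↔ I.Rel x 0 := Quotient.eq (r := I.setoid)
  refine h.trans ⟨fun h => ?_, fun h => ⟨?_, ?_⟩⟩
  · have := h.1
    rwa [lneg_zero, odot_one] at this
  · rwa [lneg_zero, odot_one]
  · exact I.mem_of_le 0 _ (odot_le_left _ _) I.zero_mem

theorem IsPrime.not_isAtom {P : NormalIdeal M} (hP : P.IsPrime) (hM : IsStrict M)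
    (x : M) : ¬ IsAtom (P.toQuot x) := by
  obtain ⟨r, hr, h0⟩ := hM
  have hw : IsWeakSquareRoot r := hr.elim (fun h => h.toIsWeakSquareRoot) id
  refine not_isAtom_of_forall_exists_odot_self ?_ ?_ ⟨P.toQuot (r 0), congrArg P.toQuot h0⟩ _
  · rintro ⟨a⟩ ⟨b⟩ h
    exact (hP a b ((P.toQuot_eq_zero_iff (inf a b)).1 h)).imp (P.toQuot_eq_zero_iff a).2
      (P.toQuot_eq_zero_iff b).2
  · rintro ⟨a⟩
    exact ⟨P.toQuot (r a), congrArg P.toQuot (hw.odot_self a)⟩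

end NormalIdeal

/-! ### Kernels and representable algebras -/

namespace IsHom

variable {M : Type u} {N : Type v} [PseudoMVAlgebra M] [PseudoMVAlgebra N] {f : M → N}

theorem map_odot (hf : IsHom f) (x y : M) : f (x ⊙ₘ y) = f x ⊙ₘ f y := by
  simp only [odot, hf.map_rneg, hf.map_oplus, hf.map_lneg]

theorem map_inf (hf : IsHom f) (x y : M) : f (inf x y) = inf (f x) (f y) := by
  simp only [inf, hf.map_odot, hf.map_oplus, hf.map_lneg]

theorem monotone (hf : IsHom f) {x y : M} (h : x ≤ y) : f x ≤ f y := by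
  rw [le_iff_inf, ← hf.map_inf, (le_iff_inf x y).1 h]

/-- The kernel of a homomorphism. -/
def ker (hf : IsHom f) : NormalIdeal M where
  carrier := {x | f x = 0}
  nonempty := ⟨0, hf.map_zero⟩
  mem_of_le x y h hx := by
    have h' := hf.monotone h
    rw [show f x = 0 from hx] at h'
    exact le_zero_iff'.1 h'
  oplus_mem x y hx hy := by
    rw [Set.mem_ofPred_eq] at *
    rw [hf.map_oplus, hx, hy, oplus_zero]
  normal x := by
    ext z
    constructor
    · rintro ⟨k, hk, rfl⟩
      -- The left difference of `x ⊕ k` and `x`: adding `x` back gives their join, which is `x ⊕ k`.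
      -- The converse inclusion uses the right difference.
      refine ⟨(x ⊕ₘ k) ⊙ₘ lneg x, ?_, ?_⟩
      · rw [Set.mem_ofPred_eq] at *
        rw [hf.map_odot, hf.map_oplus, hk, oplus_zero, hf.map_lneg, odot_lneg_self]
      · show ((x ⊕ₘ k) ⊙ₘ lneg x) ⊕ₘ x = x ⊕ₘ k
        rw [← join₂, join₁, rneg_odot, (le_iff x _).1 (le_oplus_left x k), rneg_one, oplus_zero]
    · rintro ⟨k, hk, rfl⟩
      refine ⟨rneg x ⊙ₘ (k ⊕ₘ x), ?_, ?_⟩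
      · rw [Set.mem_ofPred_eq] at *
        rw [hf.map_odot, hf.map_oplus, hk, zero_oplus, hf.map_rneg, rneg_odot,
          lneg_oplus_self, rneg_one]
      · show x ⊕ₘ (rneg x ⊙ₘ (k ⊕ₘ x)) = k ⊕ₘ x
        rw [join₁, rneg_odot, (le_iff x _).1 (le_oplus_right k x), rneg_one, oplus_zero]

theorem ker_isPrime (hf : IsHom f) (hN : ∀ a b : N, a ≤ b ∨ b ≤ a) : hf.ker.IsPrime := by
  intro x y h
  replace h : f (inf x y) = 0 := h
  rw [hf.map_inf] at h
  rcases hN (f x) (f y) with hxy | hxy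
  · exact Or.inl (((le_iff_inf _ _).1 hxy).symm.trans h)
  · rw [inf_comm'] at h
    exact Or.inr (((le_iff_inf _ _).1 hxy).symm.trans h)

end IsHom

theorem IsRepresentable.exists_isPrime_notMem {M : Type u} [PseudoMVAlgebra M]
    (hM : IsRepresentable M) {x : M} (hx : x ≠ 0) :
    ∃ P : NormalIdeal M, P.IsPrime ∧ x ∉ P.carrier := by
  obtain ⟨ι, C, _, f, hC, hf, -, hinj⟩ := hM
  obtain ⟨i, hi⟩ : ∃ i, f i x ≠ 0 := by
    by_contra! h
    exact hx (hinj (funext fun i => (h i).trans (hf i).map_zero.symm))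
  exact ⟨(hf i).ker, (hf i).ker_isPrime (hC i), hi⟩

/-! ### Prime ideals in the commutative case -/

section Ideal

variable {M : Type u} [PseudoMVAlgebra M]

/-- An ideal: a down-set containing `0` and closed under `⊕`. -/
structure IsIdeal (I : Set M) : Prop where
  zero_mem : (0 : M) ∈ I
  mem_of_le : ∀ x y : M, y ≤ x → x ∈ I → y ∈ I
  oplus_mem : ∀ x y : M, x ∈ I → y ∈ I → x ⊕ₘ y ∈ I

/-- The ideal of elements whose meet with `u` lies in `I`. -/
theorem IsIdeal.inf_mem {I : Set M} (hI : IsIdeal I) (u : M) : IsIdeal {w | inf u w ∈ I} where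
  zero_mem := hI.mem_of_le _ _ (inf_le_snd u 0) hI.zero_mem
  mem_of_le _ y h hx :=
    hI.mem_of_le _ _ (le_inf_of_le (inf_le_fst u y) ((inf_le_snd u y).trans h)) hx
  oplus_mem x y hx hy := hI.mem_of_le _ _ (inf_oplus_le u x y) (hI.oplus_mem _ _ hx hy)

theorem exists_maximal_isIdeal_notMem {x : M} (hx : x ≠ 0) :
    ∃ I : Set M, Maximal (fun I : Set M => IsIdeal I ∧ x ∉ I) I := by
  have h0 : ({0} : Set M) ∈ {I : Set M | IsIdeal I ∧ x ∉ I} := by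
    refine ⟨⟨rfl, ?_, ?_⟩, hx⟩
    · rintro a b h rfl
      exact le_zero_iff'.1 h
    · rintro a b rfl rfl
      exact oplus_zero 0
  obtain ⟨I, -, hI⟩ := zorn_subset_nonempty {I : Set M | IsIdeal I ∧ x ∉ I} (by
    intro c hc hchain ⟨I₀, hI₀⟩
    refine ⟨⋃₀ c, ⟨⟨⟨I₀, hI₀, (hc hI₀).1.zero_mem⟩, ?_, ?_⟩, ?_⟩,
      fun s hs => Set.subset_sUnion_of_mem hs⟩
    · rintro a b h ⟨J, hJ, ha⟩
      exact ⟨J, hJ, (hc hJ).1.mem_of_le a b h ha⟩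
    · rintro a b ⟨J, hJ, ha⟩ ⟨K, hK, hb⟩
      rcases hchain.total hJ hK with h | h
      · exact ⟨K, hK, (hc hK).1.oplus_mem a b (h ha) hb⟩
      · exact ⟨J, hJ, (hc hJ).1.oplus_mem a b ha (h hb)⟩
    · rintro ⟨J, hJ, ha⟩
      exact (hc hJ).2 ha) _ h0
  exact ⟨I, hI⟩

theorem IsMVAlgebra.exists_isPrime_notMem (hM : IsMVAlgebra M) {x : M} (hx : x ≠ 0) :
    ∃ P : NormalIdeal M, P.IsPrime ∧ x ∉ P.carrier := by
  obtain ⟨I, hI⟩ := exists_maximal_isIdeal_notMem hx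
  obtain ⟨hideal, hxI⟩ := hI.prop
  -- The ideal `{w | u ∧ w ∈ I}` contains `I` and also `v ∉ I`, so by maximality it cannot miss `x`.
  have hpolar : ∀ u v : M, inf u v ∈ I → v ∉ I → inf u x ∈ I := by
    intro u v huv hv
    by_contra hux
    have hle : I ≤ {w | inf u w ∈ I} := fun w hw => hideal.mem_of_le _ _ (inf_le_snd u w) hw
    exact hv (hI.le_of_ge ⟨hideal.inf_mem u, hux⟩ hle huv)
  refine ⟨⟨I, ⟨0, hideal.zero_mem⟩, hideal.mem_of_le, hideal.oplus_mem,
    fun x => by simp only [hM x]⟩, fun u v huv => ?_, hxI⟩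
  by_contra! h
  -- Two applications replace first `v` and then `u` by `x`, ending with `x ∧ x ∈ I`.
  have hux := hpolar u v huv h.2
  rw [inf_comm'] at hux
  have hxx := hpolar x u hux h.1
  rw [(le_iff_inf x x).1 le_rfl] at hxx
  exact hxI hxx

end Ideal

end PseudoMVAlgebra

theorem theorem8p1 :
    (∀ (M : Type u) [PseudoMVAlgebra M], PseudoMVAlgebra.IsRepresentable M →
      PseudoMVAlgebra.IsStrict M → PseudoMVAlgebra.IsStronglyAtomless M) ∧
    (∀ (M : Type u) [PseudoMVAlgebra M], PseudoMVAlgebra.IsMVAlgebra M →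
      PseudoMVAlgebra.IsStrict M → PseudoMVAlgebra.IsStronglyAtomless M) := by
  constructor
  · intro M _ hM hs x hx
    obtain ⟨P, hP, hxP⟩ := hM.exists_isPrime_notMem hx
    exact ⟨P, hP, hxP, hP.not_isAtom hs x⟩
  · intro M _ hM hs x hx
    obtain ⟨P, hP, hxP⟩ := hM.exists_isPrime_notMem hx
    exact ⟨P, hP, hxP, hP.not_isAtom hs x⟩
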